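/- All rings are associative with a non-zero identity element. A ring $R$ is centrally essential if for every non-zero $a\in R$ there are non-zero central elements $x,y$ of $R$ with $ax=y$; $R$ is completely centrally essential if every (non-zero) factor ring of $R$ is centrally essential. Put $[a,b]=ab-ba$. Let $R^{[1]}=R$ and let $R^{[i+1]}$ be the additive subgroup generated by all $[a,b]$ with $a\in R^{[i]}$, $b\in R$; $R$ is Lie nilpotent if $R^{[n+1]}=0$ for some positive integer $n$, and the least such $n$ is its Lie nilpotence class. Let $R^{(1)}=R$ and let $R^{(i+1)}$ be the two-sided ideal generated by all $[a,b]$ with $a\in R^{(i)}$, $b\in R$; $R$ is strongly Lie nilpotent if $R^{(m)}=0$ for some positive integer $m$. A finite central series of $R$ is a chain of two-sided ideals $0=J_0\subseteq J_1\subseteq\dots\subseteq J_m=R$ with $[a,b]\in J_i$ for all $0\le i<m$, $a\in J_{i+1}$, $b\in R$. A PI-ring is a ring in which some polynomial over $\mathbb{Z}$ in non-commuting variables, one of whose monomials of highest degree has coefficient $1$, vanishes identically. **Theorem 1.4.** Let $R$ be a completely centrally essential ring. (1) If $R$ is semiprimary, i.e. its Jacobson radical $J(R)$ is nilpotent and $R/J(R)$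 is semisimple artinian, and if $J(R)^n=0$, then $R$ is Lie nilpotent and its Lie nilpotence class is at most $n$. (2) If $R$ is (left and right) noetherian, then $R$ is strongly Lie nilpotent and has a finite central series; in particular, $R$ is a PI-ring. -/

import Mathlib

/-- A ring is centrally essential if every non-zero `a` has non-zero central `x`, `y` with
`a * x = y`. -/
def IsCentrallyEssential (R : Type*) [Ring R] : Prop :=
  ∀ a : R, a ≠ 0 → ∃ x ∈ Subring.center R, ∃ y ∈ Subring.center R, x ≠ 0 ∧ y ≠ 0 ∧ a * x = y

/-- Every factor ring (by a two-sided ideal) is centrally essential. The zero factor ring `R ⧸ ⊤`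
satisfies the condition vacuously. -/
def IsCompletelyCentrallyEssential (R : Type*) [Ring R] : Prop :=
  ∀ (I : Ideal R) [I.IsTwoSided], IsCentrallyEssential (R ⧸ I)

/-- The Lie powers of `R`, with the index starting at `0`: `lieSeries R k` is `R^[k+1]`, where
`R^[1] = R` and `R^[i+1]` is the additive subgroup generated by all `a * b - b * a` with
`a ∈ R^[i]` and `b ∈ R`. -/
def lieSeries (R : Type*) [Ring R] : ℕ → AddSubgroup R
  | 0 => ⊤
  | k + 1 => AddSubgroup.closure {z | ∃ a ∈ lieSeries R k, ∃ b : R, z = a * b - b * a}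

/-- `R^[n+1] = 0` for some positive integer `n`. -/
def IsLieNilpotent (R : Type*) [Ring R] : Prop :=
  ∃ n : ℕ, 0 < n ∧ lieSeries R n = ⊥

/-- The least positive integer `n` with `R^[n+1] = 0` (meaningful when `R` is Lie nilpotent). -/
noncomputable def lieNilpotenceClass (R : Type*) [Ring R] : ℕ :=
  sInf {n : ℕ | 0 < n ∧ lieSeries R n = ⊥}

/-- The strong Lie powers of `R`, with the index starting at `0`: `strongLieSeries R k` is
`R^(k+1)`, where `R^(1) = R` and `R^(i+1)` is the two-sided ideal generated by all
`a * b - b * a` with `a ∈ R^(i)` and `b ∈ R`. -/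
def strongLieSeries (R : Type*) [Ring R] : ℕ → TwoSidedIdeal R
  | 0 => ⊤
  | k + 1 => TwoSidedIdeal.span {z | ∃ a ∈ strongLieSeries R k, ∃ b : R, z = a * b - b * a}

/-- `R^(m) = 0` for some positive integer `m`. -/
def IsStronglyLieNilpotent (R : Type*) [Ring R] : Prop :=
  ∃ k : ℕ, strongLieSeries R k = ⊥

/-- There is a finite chain `0 = J 0 ⊆ J 1 ⊆ ⋯ ⊆ J m = R` of two-sided ideals in which every
factor `J (i+1) / J i` is central, that is, `[J (i+1), R] ⊆ J i`. -/
def HasFiniteCentralSeries (R : Type*) [Ring R] : Prop :=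
  ∃ (m : ℕ) (J : ℕ → TwoSidedIdeal R), J 0 = ⊥ ∧ J m = ⊤ ∧
    ∀ i < m, J i ≤ J (i + 1) ∧ ∀ a ∈ J (i + 1), ∀ b : R, a * b - b * a ∈ J i

/-- A PI-ring: some polynomial with integer coefficients in non-commuting variables, one of whose
monomials of highest degree has coefficient `1`, vanishes under all substitutions of elements of
the ring for the variables. -/
def IsPIRing (R : Type*) [Ring R] : Prop :=
  ∃ f : FreeAlgebra ℤ ℕ,
    (∃ w : FreeMonoid ℕ,
      (FreeAlgebra.equivMonoidAlgebraFreeMonoid f).coeff w = 1 ∧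
      ∀ v : FreeMonoid ℕ, (FreeAlgebra.equivMonoidAlgebraFreeMonoid f).coeff v ≠ 0 →
        v.length ≤ w.length) ∧
    ∀ s : ℕ → R, FreeAlgebra.lift ℤ s f = 0

/-! In a centrally essential ring with reduced centre, suppose `y = [a, b] * x ≠ 0` is central.
Some non-zero central multiple `w` of `y` makes `a * w` central. Then `[a, b] * w = [a * w, b] = 0`,
so `w * w = 0`, a contradiction. Hence such a ring is commutative.

For (1), write `J` for the radical and let `a ∈ J ^ k`. The semisimple ring `R ⧸ J` is commutative
by the above, and `J` annihilates `a` modulo `J ^ (k + 1)`. Split `R ⧸ J` into the image of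
`{r | r * a lies in the largest central ideal of R ⧸ J ^ (k + 1)}` and a complement. Central
essentiality makes the complement annihilate `a`, so `a` is central modulo `J ^ (k + 1)`.

For (2), factor out a maximal nilpotent ideal `N`. The centre of the quotient is reduced, so all
commutators lie in `N`. Given a proper two-sided ideal `I`, choose `k` with `N ^ (k + 1) ≤ I` but
not `N ^ k ≤ I`. Modulo `I`, a non-zero central multiple of an element of `N ^ k` is annihilated by
all commutators, hence generates a central ideal. Noetherian induction on `I` finishes the proof. -/

section CentralIdeal

variable {R : Type*} [Ring R]

variable (R) in
/-- The largest ideal of `R` contained in the centre, encoded by the elements all of whose left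
multiples are central. An ideal chain whose steps land in it modulo the previous term is a central
series. -/
def centralIdeal : Ideal R where
  carrier := {z | ∀ r : R, r * z ∈ Subring.center R}
  zero_mem' r := by simp only [mul_zero, zero_mem]
  add_mem' hy hz r := by simpa only [mul_add] using add_mem (hy r) (hz r)
  smul_mem' s z hz r := by simpa only [smul_eq_mul, mul_assoc] using hz (r * s)

theorem mem_center_of_mem_centralIdeal {z : R} (hz : z ∈ centralIdeal R) :
    z ∈ Subring.center R :=
  one_mul z ▸ hz 1

instance : (centralIdeal R).IsTwoSided :=
  ⟨fun s hz ↦ Subring.mem_center_iff.1 (mem_center_of_mem_centralIdeal hz) s ▸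
    (centralIdeal R).mul_mem_left s hz⟩

theorem mem_centralIdeal_of_commutator_mul_eq_zero {z : R} (hz : z ∈ Subring.center R)
    (h : ∀ a b : R, (a * b - b * a) * z = 0) : z ∈ centralIdeal R := fun r ↦ by
  refine Subring.mem_center_iff.2 fun s ↦ ?_
  have hsr : s * r * z = r * s * z := by rw [← sub_eq_zero, ← sub_mul, h]
  rw [← mul_assoc, hsr, mul_assoc, mul_assoc, Subring.mem_center_iff.1 hz s]

end CentralIdeal

section ReducedCenter

variable {R : Type*} [Ring R]

theorem isReduced_center_iff :
    IsReduced (Subring.center R) ↔ ∀ z ∈ Subring.center R, z * z = 0 → z = 0 := by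
  simp only [isReduced_iff_pow_one_lt 2 one_lt_two, Subtype.forall, Subtype.ext_iff,
    sq, Subring.coe_mul, Subring.coe_zero]

instance isReduced_center_of_isSemisimpleRing [IsSemisimpleRing R] :
    IsReduced (Subring.center R) := by
  refine isReduced_center_iff.2 fun z hz hzz ↦ ?_
  obtain ⟨V, hV⟩ := exists_isCompl (Ideal.span {z})
  obtain ⟨u, hu, v, hv, huv⟩ := Submodule.mem_sup.1 (hV.sup_eq_top ▸ Submodule.mem_top (x := 1))
  obtain ⟨r, rfl⟩ := Ideal.mem_span_singleton'.1 hu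
  have hzv : z * v = z := by
    rw [← Subring.mem_center_iff.1 hz, eq_sub_of_add_eq' huv, sub_mul, mul_assoc r, hzz, one_mul,
      mul_zero, sub_zero]
  exact (Submodule.mem_bot R).1 (hV.inf_eq_bot ▸
    ⟨Ideal.mem_span_singleton_self z, hzv ▸ V.mul_mem_left z hv⟩)

theorem isReduced_center_quotient (N : Ideal R) [N.IsTwoSided]
    (hN : ∀ (M : Ideal R) [M.IsTwoSided], N ≤ M → M * M ≤ N → M ≤ N) :
    IsReduced (Subring.center (R ⧸ N)) := by
  refine isReduced_center_iff.2 fun z hz hzz ↦ ?_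
  have hzc := Subring.mem_center_iff.1 hz
  have : (Ideal.span {z}).IsTwoSided := ⟨fun s hy ↦ by
    obtain ⟨r, rfl⟩ := Ideal.mem_span_singleton'.1 hy
    exact Ideal.mem_span_singleton'.2 ⟨r * s, by rw [mul_assoc, hzc, mul_assoc]⟩⟩
  have hNM : N ≤ (Ideal.span {z}).comap (Ideal.Quotient.mk N) := fun x hx ↦ by
    rw [Ideal.mem_comap, Ideal.Quotient.eq_zero_iff_mem.2 hx]
    exact zero_mem _
  have hsq : (Ideal.span {z}).comap (Ideal.Quotient.mk N) *
      (Ideal.span {z}).comap (Ideal.Quotient.mk N) ≤ N := by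
    refine Ideal.mul_le.2 fun r hr s hs ↦ Ideal.Quotient.eq_zero_iff_mem.1 ?_
    rw [map_mul, ← Submodule.mem_bot (R ⧸ N), ← Ideal.span_singleton_zero, ← hzz,
      ← Ideal.span_singleton_mul_span_singleton]
    exact Ideal.mul_mem_mul hr hs
  obtain ⟨x, rfl⟩ := Ideal.Quotient.mk_surjective z
  exact Ideal.Quotient.eq_zero_iff_mem.2
    (hN _ hNM hsq (Ideal.mem_comap.2 (Ideal.mem_span_singleton_self _)))

end ReducedCenter

namespace IsCentrallyEssential

variable {R : Type*} [Ring R]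

theorem exists_mul_mem_center (hR : IsCentrallyEssential R) {a : R} (ha : a ≠ 0) :
    ∃ x ∈ Subring.center R, a * x ≠ 0 ∧ a * x ∈ Subring.center R := by
  obtain ⟨x, hx, y, hy, -, hy0, rfl⟩ := hR a ha
  exact ⟨x, hx, hy0, hy⟩

theorem mul_comm_of_isReduced_center [IsReduced (Subring.center R)]
    (hR : IsCentrallyEssential R) (a b : R) : a * b = b * a := by
  by_contra hab
  obtain ⟨x, -, hy0, hy⟩ := hR.exists_mul_mem_center (sub_ne_zero.2 hab)
  set y := (a * b - b * a) * x with y_def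
  have y_mul_eq_zero : ∀ w ∈ Subring.center R, a * w ∈ Subring.center R → y * w = 0 := by
    intro w hw haw
    have hcw : (a * b - b * a) * w = 0 := by
      rw [sub_mul, mul_assoc, mul_assoc, Subring.mem_center_iff.1 hw b, ← mul_assoc,
        ← Subring.mem_center_iff.1 haw b, sub_self]
    rw [y_def, mul_assoc, Subring.mem_center_iff.1 hw x, ← mul_assoc, hcw, zero_mul]
  obtain ⟨w, hw, hyw0, hayw⟩ :
      ∃ w ∈ Subring.center R, y * w ≠ 0 ∧ a * (y * w) ∈ Subring.center R := by
    by_cases hay : a * y = 0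
    · exact ⟨1, one_mem _, by rwa [mul_one], by rw [mul_one, hay]; exact zero_mem _⟩
    · obtain ⟨w, hw, h0, hc⟩ := hR.exists_mul_mem_center hay
      rw [mul_assoc] at h0 hc
      exact ⟨w, hw, right_ne_zero_of_mul h0, hc⟩
  have hyw : y * w ∈ Subring.center R := mul_mem hy hw
  refine hyw0 (isReduced_center_iff.1 ‹_› _ hyw ?_)
  rw [mul_assoc, ← Subring.mem_center_iff.1 hw (y * w), ← mul_assoc, y_mul_eq_zero _ hyw hayw,
    zero_mul]

theorem mem_centralIdeal_of_ker_mul_eq_zero {F : Type*} [Ring F] [IsSemisimpleRing F]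
    (hR : IsCentrallyEssential R) (f : R →+* F) (hf : Function.Surjective f)
    (hF : ∀ x y : F, x * y = y * x) {a : R} (ha : ∀ j ∈ RingHom.ker f, j * a = 0) :
    a ∈ centralIdeal R := by
  let U : Ideal R := Submodule.comap (LinearMap.toSpanSingleton R R a) (centralIdeal R)
  obtain ⟨V, hUV⟩ := exists_isCompl (U.map f)
  have mul_eq_zero_of_mem : ∀ v, f v ∈ V → v * a = 0 := by
    intro v hv
    by_contra hva
    obtain ⟨x, hx, h0, hc⟩ := hR.exists_mul_mem_center hva
    have hxv : v * a * x = x * v * a := by rw [Subring.mem_center_iff.1 hx, ← mul_assoc]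
    rw [hxv] at h0 hc
    have hxvU : x * v ∈ U := by
      refine mem_centralIdeal_of_commutator_mul_eq_zero hc fun r s ↦ ?_
      have hrs : (r * s - s * r) * (x * v) ∈ RingHom.ker f := by
        rw [RingHom.mem_ker, map_mul, map_sub, map_mul, map_mul, hF (f r), sub_self, zero_mul]
      exact (mul_assoc _ (x * v) a).symm.trans (ha _ hrs)
    refine h0 (ha _ ((Submodule.mem_bot F).1 (hUV.inf_eq_bot ▸ ⟨Ideal.mem_map_of_mem f hxvU, ?_⟩)))
    exact map_mul f x v ▸ V.mul_mem_left _ hv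
  obtain ⟨u', hu, v', hv, huv⟩ :=
    Submodule.mem_sup.1 (hUV.sup_eq_top ▸ Submodule.mem_top (x := f 1))
  obtain ⟨u, huU, rfl⟩ := (Ideal.mem_map_iff_of_surjective f hf).1 hu
  have hva : (1 - u) * a = 0 :=
    mul_eq_zero_of_mem _ (by rwa [map_sub, ← huv, add_sub_cancel_left])
  rw [sub_mul, one_mul, sub_eq_zero] at hva
  rw [hva]
  exact huU

end IsCentrallyEssential

section Series

variable {R : Type*} [Ring R]

theorem commutator_mem_strongLieSeries_succ {k : ℕ} {a : R} (ha : a ∈ strongLieSeries R k)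
    (b : R) : a * b - b * a ∈ strongLieSeries R (k + 1) :=
  TwoSidedIdeal.subset_span ⟨a, ha, b, rfl⟩

theorem strongLieSeries_succ_le {k : ℕ} {I K : TwoSidedIdeal R} (hK : strongLieSeries R k ≤ K)
    (hKI : ∀ a ∈ K, ∀ b : R, a * b - b * a ∈ I) : strongLieSeries R (k + 1) ≤ I := by
  refine TwoSidedIdeal.span_le.2 ?_
  rintro _ ⟨a, ha, b, rfl⟩
  exact hKI a (hK ha) b

theorem antitone_strongLieSeries : Antitone (strongLieSeries R) :=
  antitone_nat_of_succ_le fun k ↦ strongLieSeries_succ_le le_rfl fun _ ha _ ↦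
    sub_mem ((strongLieSeries R k).mul_mem_right _ _ ha)
      ((strongLieSeries R k).mul_mem_left _ _ ha)

theorem mem_strongLieSeries_of_mem_lieSeries {k : ℕ} {x : R} (hx : x ∈ lieSeries R k) :
    x ∈ strongLieSeries R k := by
  induction k generalizing x with
  | zero => trivial
  | succ k ih =>
    induction hx using AddSubgroup.closure_induction with
    | mem x hx =>
      obtain ⟨a, ha, b, rfl⟩ := hx
      exact commutator_mem_strongLieSeries_succ (ih ha) b
    | zero => exact zero_mem _
    | add x y _ _ hx hy => exact add_mem hx hy
    | neg x _ hx => exact neg_mem hx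

theorem lieSeries_eq_bot {k : ℕ} (hk : strongLieSeries R k = ⊥) : lieSeries R k = ⊥ :=
  (AddSubgroup.eq_bot_iff_forall _).2 fun _ hx ↦
    (TwoSidedIdeal.mem_bot R).1 (hk ▸ mem_strongLieSeries_of_mem_lieSeries hx)

theorem IsStronglyLieNilpotent.isLieNilpotent (h : IsStronglyLieNilpotent R) :
    IsLieNilpotent R := by
  obtain ⟨k, hk⟩ := h
  exact ⟨k + 1, k.succ_pos, lieSeries_eq_bot
    (le_bot_iff.1 (hk ▸ antitone_strongLieSeries k.le_succ))⟩

theorem IsStronglyLieNilpotent.hasFiniteCentralSeries (h : IsStronglyLieNilpotent R) :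
    HasFiniteCentralSeries R := by
  obtain ⟨k, hk⟩ := h
  refine ⟨k, fun i ↦ strongLieSeries R (k - i), hk, by simp only [Nat.sub_self]; rfl,
    fun i hi ↦ ⟨antitone_strongLieSeries (by lia), fun a ha b ↦ ?_⟩⟩
  simp only [show k - i = k - (i + 1) + 1 by lia]
  exact commutator_mem_strongLieSeries_succ ha b

end Series

section PolynomialIdentity

/-- The left-normed commutator `[[[x, y], y], …, y]` with `k` entries `y`. Evaluated at free
generators, it is the polynomial identity of a Lie nilpotent ring. -/
def engelCommutator {A : Type*} [Ring A] (x y : A) : ℕ → A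
  | 0 => x
  | k + 1 => engelCommutator x y k * y - y * engelCommutator x y k

theorem map_engelCommutator {A B : Type*} [Ring A] [Ring B] (f : A →+* B) (x y : A) (k : ℕ) :
    f (engelCommutator x y k) = engelCommutator (f x) (f y) k := by
  induction k with
  | zero => rfl
  | succ k ih => simp only [engelCommutator, map_sub, map_mul, ih]

theorem engelCommutator_mem_lieSeries {A : Type*} [Ring A] (x y : A) (k : ℕ) :
    engelCommutator x y k ∈ lieSeries A k := by
  induction k with
  | zero => trivial
  | succ k ih => exact AddSubgroup.subset_closure ⟨_, ih, y, rfl⟩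

variable {A α : Type*} [Ring A]

open MonoidAlgebra

theorem coeff_engelCommutator_single {a b : α} (hab : a ≠ b) (k : ℕ) :
    (engelCommutator (single (FreeMonoid.of a) (1 : A)) (single (FreeMonoid.of b) 1) k).coeff
      (FreeMonoid.of a * FreeMonoid.of b ^ k) = 1 := by
  induction k with
  | zero => simp only [engelCommutator, pow_zero, mul_one, coeff_single, Finsupp.single_eq_same]
  | succ k ih =>
    have hne : ∀ d, FreeMonoid.of b * d ≠ FreeMonoid.of a * FreeMonoid.of b ^ (k + 1) :=
      fun d h ↦ hab (List.cons.inj h).1.symm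
    rw [engelCommutator, coeff_sub, Finsupp.sub_apply, coeff_single_mul_of_forall_mul_ne _ _ hne,
      pow_succ, ← mul_assoc, coeff_mul_single_mul, ih, mul_one, sub_zero]

theorem length_of_coeff_engelCommutator_single_ne_zero (a b : α) (k : ℕ) {v : FreeMonoid α}
    (hv : (engelCommutator (single (FreeMonoid.of a) (1 : A))
      (single (FreeMonoid.of b) 1) k).coeff v ≠ 0) : v.length = k + 1 := by
  classical
  induction k generalizing v with
  | zero =>
    rw [Finset.mem_singleton.1 (Finsupp.support_single_subset (Finsupp.mem_support_iff.2 hv))]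
    rfl
  | succ k ih =>
    rcases Finset.mem_union.1 (Finsupp.support_sub (Finsupp.mem_support_iff.2 hv)) with h | h
    · obtain ⟨u, hu, rfl⟩ := Finset.mem_image.1 (support_coeff_mul_single_subset _ _ _ h)
      rw [FreeMonoid.length_mul, ih (Finsupp.mem_support_iff.1 hu), FreeMonoid.length_of]
    · obtain ⟨u, hu, rfl⟩ := Finset.mem_image.1 (support_coeff_single_mul_subset _ _ _ h)
      rw [FreeMonoid.length_mul, ih (Finsupp.mem_support_iff.1 hu), FreeMonoid.length_of, add_comm]

theorem IsLieNilpotent.isPIRing {R : Type*} [Ring R] (h : IsLieNilpotent R) : IsPIRing R := by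
  obtain ⟨k, -, hk⟩ := h
  let e := FreeAlgebra.equivMonoidAlgebraFreeMonoid (R := ℤ) (X := ℕ)
  let f := engelCommutator (FreeAlgebra.ι ℤ 0) (FreeAlgebra.ι ℤ 1) k
  have hι (n : ℕ) : e (FreeAlgebra.ι ℤ n) = single (FreeMonoid.of n) 1 := by
    simp [e, FreeAlgebra.equivMonoidAlgebraFreeMonoid]
  have hef : e f = engelCommutator (single (FreeMonoid.of 0) 1) (single (FreeMonoid.of 1) 1) k := by
    rw [← hι 0, ← hι 1]
    exact map_engelCommutator (e : FreeAlgebra ℤ ℕ →+* MonoidAlgebra ℤ (FreeMonoid ℕ)) _ _ k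
  refine ⟨f, ⟨FreeMonoid.of 0 * FreeMonoid.of 1 ^ k, ?_, fun v hv ↦ ?_⟩, fun s ↦ ?_⟩
  · exact hef ▸ coeff_engelCommutator_single zero_ne_one k
  · have hw := coeff_engelCommutator_single (A := ℤ) (zero_ne_one (α := ℕ)) k
    rw [length_of_coeff_engelCommutator_single_ne_zero 0 1 k (hef ▸ hv),
      length_of_coeff_engelCommutator_single_ne_zero 0 1 k (hw.trans_ne one_ne_zero)]
  · rw [← AddSubgroup.mem_bot, ← hk]
    exact (map_engelCommutator (FreeAlgebra.lift ℤ s : FreeAlgebra ℤ ℕ →+* R) _ _ k).symm ▸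
      engelCommutator_mem_lieSeries _ _ k

end PolynomialIdentity

theorem isNilpotent_of_mul_self_le {R : Type*} [Ring R] {M N : Ideal R} [M.IsTwoSided]
    (hN : IsNilpotent N) (hMN : M * M ≤ N) : IsNilpotent M := by
  have hpow (k : ℕ) : M ^ (2 * k) ≤ N ^ k := by
    induction k with
    | zero => rw [mul_zero, Submodule.pow_zero, Submodule.pow_zero]
    | succ k ih =>
      rw [mul_add_one, Ideal.IsTwoSided.pow_add, Submodule.pow_succ (M := N)]
      exact Ideal.mul_mono ih (by rwa [Submodule.pow_succ, Submodule.pow_one])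
  obtain ⟨n, hn⟩ := hN
  exact ⟨2 * n, le_bot_iff.1 ((hpow n).trans hn.le)⟩

instance wellFoundedGT_twoSidedIdeal {R : Type*} [Ring R] [IsNoetherianRing R] :
    WellFoundedGT (TwoSidedIdeal R) :=
  (TwoSidedIdeal.asIdeal.monotone.strictMono_of_injective
    fun _ _ h ↦ SetLike.ext fun x ↦ SetLike.ext_iff.1 h x).wellFoundedGT

namespace IsCompletelyCentrallyEssential

variable {R : Type*} [Ring R]

theorem commutator_mem_pow_succ (hR : IsCompletelyCentrallyEssential R) (J : Ideal R)
    [J.IsTwoSided] [IsSemisimpleRing (R ⧸ J)] (k : ℕ) {a : R} (ha : a ∈ J ^ k) (b : R) :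
    a * b - b * a ∈ J ^ (k + 1) := by
  have hle : J ^ (k + 1) ≤ J := by
    rw [Submodule.pow_succ]
    exact Ideal.mul_le_right
  have ker_mul_eq_zero : ∀ j ∈ RingHom.ker (Ideal.Quotient.factor hle),
      j * Ideal.Quotient.mk (J ^ (k + 1)) a = 0 := by
    intro j hj
    obtain ⟨j, rfl⟩ := Ideal.Quotient.mk_surjective j
    rw [RingHom.mem_ker, Ideal.Quotient.factor_mk, Ideal.Quotient.eq_zero_iff_mem] at hj
    rw [← map_mul, Ideal.Quotient.eq_zero_iff_mem, Ideal.IsTwoSided.pow_succ]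
    exact Ideal.mul_mem_mul hj ha
  have hac := (hR (J ^ (k + 1))).mem_centralIdeal_of_ker_mul_eq_zero
    (Ideal.Quotient.factor hle) (Ideal.Quotient.factor_surjective hle)
    (hR J).mul_comm_of_isReduced_center ker_mul_eq_zero
  rw [← Ideal.Quotient.eq, map_mul, map_mul]
  exact (Subring.mem_center_iff.1 (mem_center_of_mem_centralIdeal hac) _).symm

theorem strongLieSeries_le_pow (hR : IsCompletelyCentrallyEssential R) (J : Ideal R)
    [J.IsTwoSided] [IsSemisimpleRing (R ⧸ J)] (k : ℕ) :
    strongLieSeries R k ≤ (J ^ k).toTwoSided := by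
  induction k with
  | zero =>
    intro x _
    rw [Ideal.mem_toTwoSided, Submodule.pow_zero, Ideal.one_eq_top]
    exact Submodule.mem_top
  | succ k ih =>
    refine strongLieSeries_succ_le ih fun a ha b ↦ ?_
    rw [Ideal.mem_toTwoSided] at ha ⊢
    exact hR.commutator_mem_pow_succ J k ha b

theorem exists_isNilpotent_commutator_mem [WellFoundedGT (TwoSidedIdeal R)]
    (hR : IsCompletelyCentrallyEssential R) :
    ∃ N : Ideal R, N.IsTwoSided ∧ IsNilpotent N ∧ ∀ a b : R, a * b - b * a ∈ N := by
  obtain ⟨N, hN, hmax⟩ := exists_maximal_of_wellFoundedGT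
    (fun N : TwoSidedIdeal R ↦ IsNilpotent N.asIdeal) ⟨⊥, 1, Submodule.pow_one _⟩
  refine ⟨N.asIdeal, inferInstance, hN, fun a b ↦ ?_⟩
  have := isReduced_center_quotient N.asIdeal fun M _ hNM hMM ↦ by
    have hM : IsNilpotent M.toTwoSided.asIdeal := by
      rw [Ideal.asIdeal_toTwoSided]
      exact isNilpotent_of_mul_self_le hN hMM
    have hle : M.toTwoSided ≤ N := hmax hM fun x hx ↦ Ideal.mem_toTwoSided.2 (hNM hx)
    exact fun x hx ↦ hle (Ideal.mem_toTwoSided.2 hx)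
  rw [← Ideal.Quotient.eq, map_mul, map_mul, (hR _).mul_comm_of_isReduced_center]

theorem exists_gt_commutator_mem (hR : IsCompletelyCentrallyEssential R) {N : Ideal R}
    [N.IsTwoSided] (hN : IsNilpotent N) (hcomm : ∀ a b : R, a * b - b * a ∈ N)
    {I : TwoSidedIdeal R} (hI : I ≠ ⊤) :
    ∃ K : TwoSidedIdeal R, I < K ∧ ∀ a ∈ K, ∀ b, a * b - b * a ∈ I := by
  obtain ⟨k, hk, hk_succ⟩ : ∃ k, ¬N ^ k ≤ I.asIdeal ∧ N ^ (k + 1) ≤ I.asIdeal := by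
    refine Nat.exists_not_and_succ_of_not_zero_of_exists (fun h ↦ hI (top_le_iff.1 fun x _ ↦ ?_))
      (hN.imp fun n hn ↦ hn.le.trans bot_le)
    rw [Submodule.pow_zero, Ideal.one_eq_top] at h
    exact h Submodule.mem_top
  obtain ⟨a, ha, haI⟩ := SetLike.not_le_iff_exists.1 hk
  obtain ⟨x, -, hz0, hz⟩ :=
    (hR I.asIdeal).exists_mul_mem_center (mt Ideal.Quotient.eq_zero_iff_mem.1 haI)
  have hz_mem := mem_centralIdeal_of_commutator_mul_eq_zero hz fun b c ↦ by
    obtain ⟨b, rfl⟩ := Ideal.Quotient.mk_surjective b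
    obtain ⟨c, rfl⟩ := Ideal.Quotient.mk_surjective c
    have hbca : (b * c - c * b) * a ∈ I.asIdeal :=
      hk_succ (Ideal.IsTwoSided.pow_succ (I := N) k ▸ Ideal.mul_mem_mul (hcomm b c) ha)
    rw [← mul_assoc, ← map_mul, ← map_mul, ← map_sub, ← map_mul,
      Ideal.Quotient.eq_zero_iff_mem.2 hbca, zero_mul]
  obtain ⟨x, rfl⟩ := Ideal.Quotient.mk_surjective x
  rw [← map_mul] at hz0 hz_mem
  refine ⟨((centralIdeal (R ⧸ I.asIdeal)).comap (Ideal.Quotient.mk I.asIdeal)).toTwoSided,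
    SetLike.lt_iff_le_and_exists.2 ⟨fun y hy ↦ ?_, a * x, Ideal.mem_toTwoSided.2 hz_mem,
      fun h ↦ hz0 (Ideal.Quotient.eq_zero_iff_mem.2 h)⟩, fun y hy b ↦ ?_⟩
  · rw [Ideal.mem_toTwoSided, Ideal.mem_comap, Ideal.Quotient.eq_zero_iff_mem.2 hy]
    exact zero_mem _
  · rw [Ideal.mem_toTwoSided] at hy
    rw [← TwoSidedIdeal.mem_asIdeal, ← Ideal.Quotient.eq, map_mul, map_mul]
    exact (Subring.mem_center_iff.1 (mem_center_of_mem_centralIdeal hy) _).symm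

theorem isStronglyLieNilpotent [WellFoundedGT (TwoSidedIdeal R)]
    (hR : IsCompletelyCentrallyEssential R) : IsStronglyLieNilpotent R := by
  obtain ⟨N, _, hN, hcomm⟩ := hR.exists_isNilpotent_commutator_mem
  suffices h : ∀ I : TwoSidedIdeal R, ∃ k, strongLieSeries R k ≤ I from
    (h ⊥).imp fun _ ↦ le_bot_iff.1
  intro I
  induction I using WellFoundedGT.induction with
  | ind I ih =>
    rcases eq_or_ne I ⊤ with rfl | hI
    · exact ⟨0, le_top⟩
    · obtain ⟨K, hIK, hKI⟩ := hR.exists_gt_commutator_mem hN hcomm hI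
      obtain ⟨k, hk⟩ := ih K hIK
      exact ⟨k + 1, strongLieSeries_succ_le hk hKI⟩

end IsCompletelyCentrallyEssential

theorem theorem1p4_general {R : Type*} [Ring R] [Nontrivial R]
    (hR : IsCompletelyCentrallyEssential R) :
    (IsSemiprimaryRing R → ∀ n : ℕ, Ring.jacobson R ^ n = ⊥ →
      IsLieNilpotent R ∧ lieNilpotenceClass R ≤ n) ∧
    (WellFoundedGT (TwoSidedIdeal R) →
      IsStronglyLieNilpotent R ∧ HasFiniteCentralSeries R ∧ IsPIRing R) := by
  refine ⟨fun _ n hn ↦ ?_, fun _ ↦ ?_⟩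
  · have n_pos : 0 < n := Nat.pos_of_ne_zero fun h ↦ by
      rw [h, Submodule.pow_zero, Ideal.one_eq_top] at hn
      exact top_ne_bot hn
    have hbot : lieSeries R n = ⊥ := lieSeries_eq_bot <| le_bot_iff.1 fun x hx ↦ by
      have hx := hR.strongLieSeries_le_pow (Ring.jacobson R) n hx
      rwa [Ideal.mem_toTwoSided, hn] at hx
    exact ⟨⟨n, n_pos, hbot⟩, Nat.sInf_le ⟨n_pos, hbot⟩⟩
  · have hnil := hR.isStronglyLieNilpotent
    exact ⟨hnil, hnil.hasFiniteCentralSeries, hnil.isLieNilpotent.isPIRing⟩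

theorem theorem1p4 {R : Type*} [Ring R] [Nontrivial R]
    (hR : IsCompletelyCentrallyEssential R) :
    (IsSemiprimaryRing R → ∀ n : ℕ, Ring.jacobson R ^ n = ⊥ →
      IsLieNilpotent R ∧ lieNilpotenceClass R ≤ n) ∧
    (IsNoetherianRing R → IsNoetherianRing Rᵐᵒᵖ →
      IsStronglyLieNilpotent R ∧ HasFiniteCentralSeries R ∧ IsPIRing R) :=
  ⟨(theorem1p4_general hR).1, fun _ _ ↦ (theorem1p4_general hR).2 inferInstance⟩
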